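/- Let $\mathcal{E}$ and $\mathcal{E}_c$ be two nested ellipses in the Euclidean plane ($\mathcal{E}_c$ lies in the open region bounded by $\mathcal{E}$), where $\mathcal{E}$ is not a circle. Suppose that they admit a Poncelet family $\mathcal{T}$ of triangles, i.e. that at least one triangle has its vertices on $\mathcal{E}$ and its three sidelines tangent to $\mathcal{E}_c$, and let $\mathcal{T}$ be the family of all such triangles. Let $\mathcal{K}$ be a circle with center $O$ (any point of the plane) and radius $r>0$. For $ABC\in\mathcal{T}$ whose circumcircle does not pass through $O$, let $A',B',C'$ be the inverses of $A,B,C$ with respect to $\mathcal{K}$, and let $X_3'$ be the circumcenter of the inversive triangle $A'B'C'$. Then the locus $\mathcal{L}_3'$ of all these points $X_3'$ is a nondegenerate conic: it is nonempty, and it is exactly the set of points $(x,y)$ of the plane with $v^{\mathsf T}Mv=0$, $v=(x,y,1)^{\mathsf T}$, for some symmetric real $3\times 3$ matrix $M$ with $\det M\neq 0$ (that is, a whole ellipse or circle, parabola, or hyperbola). -/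

import Mathlib

/-- An ellipse in the Euclidean plane `ℂ`, in arbitrary position: its center, a unit vector `dir`
giving the direction of the first axis, and the lengths `a`, `b` of the two semiaxes along `dir`
and along `I * dir`. Circles are the ellipses with `a = b`. -/
structure Ellipse where
  center : ℂ
  dir : ℂ
  norm_dir : ‖dir‖ = 1
  a : ℝ
  b : ℝ
  a_pos : 0 < a
  b_pos : 0 < b

namespace Ellipse

/-- The Cartesian coordinates `x + i y` of a point in the frame given by the center and the axes. -/
noncomputable def coord (E : Ellipse) (z : ℂ) : ℂ :=
  (starRingEnd ℂ) E.dir * (z - E.center)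

/-- The curve `(x/a)² + (y/b)² = 1`. -/
def curve (E : Ellipse) : Set ℂ :=
  {z | ((E.coord z).re / E.a) ^ 2 + ((E.coord z).im / E.b) ^ 2 = 1}

/-- The interior `(x/a)² + (y/b)² < 1`. -/
def inside (E : Ellipse) : Set ℂ :=
  {z | ((E.coord z).re / E.a) ^ 2 + ((E.coord z).im / E.b) ^ 2 < 1}

/-- A line is tangent to an ellipse when it meets the ellipse in exactly one point. -/
def IsTangent (E : Ellipse) (l : AffineSubspace ℝ ℂ) : Prop :=
  ∃! z : ℂ, z ∈ l ∧ z ∈ E.curve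

end Ellipse

/-- `ABC` is a Poncelet triangle of `E` and `Ec`: its vertices lie on `E` and its three
sidelines are tangent to `Ec`. -/
def IsPonceletTriangle (E Ec : Ellipse) (T : Affine.Triangle ℝ ℂ) : Prop :=
  (∀ i, T.points i ∈ E.curve) ∧
    ∀ i j, i ≠ j → Ec.IsTangent (affineSpan ℝ {T.points i, T.points j})

/-- `T'` is the inversive triangle of `T` with respect to the circle with center `O` and radius
`r`: the vertices of `T'` are the inverses of the vertices of `T`. The center `O` has no inverse
and must not be a vertex of `T`. -/
def IsInversiveTriangle (O : ℂ) (r : ℝ) (T T' : Affine.Triangle ℝ ℂ) : Prop :=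
  ∀ i, T.points i ≠ O ∧ T'.points i = EuclideanGeometry.inversion O r (T.points i)

/-- The locus of the circumcenter of the inversive triangle over the Poncelet family of `E` and
`Ec`. A Poncelet triangle whose circumcircle passes through `O` contributes no point, since the
inverses of its vertices are undefined or collinear. -/
def inversiveCircumcenterLocus (E Ec : Ellipse) (O : ℂ) (r : ℝ) : Set ℂ :=
  {X | ∃ T T' : Affine.Triangle ℝ ℂ, IsPonceletTriangle E Ec T ∧
    IsInversiveTriangle O r T T' ∧ X = T'.circumcenter}

/-- A set of points of the plane is a nondegenerate real conic (an ellipse, possibly a circle, a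
parabola, or a complete hyperbola) when it is the nonempty set of zeros of a polynomial of degree
two in `x`, `y` whose symmetric `3 × 3` matrix is invertible. -/
def IsNondegenerateConic (S : Set ℂ) : Prop :=
  S.Nonempty ∧ ∃ M : Matrix (Fin 3) (Fin 3) ℝ, M.IsSymm ∧ M.det ≠ 0 ∧
    S = {z : ℂ | dotProduct ![z.re, z.im, 1] (M.mulVec ![z.re, z.im, 1]) = 0}

/-!
An affine map turns `E` into the unit circle and `Ec` into an ellipse `u ↦ c + α u + β ū` of the
unit disc, with foci `f`, `g` in the disc. Tangency of the chord `z w` to the latter is a symmetric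
biquadratic equation in `z`, `w` (`existsUnique_mem_chord_iff`). If one triangle of the family
exists, this equation, multiplied by `z - w`, becomes `B(z) = B(w)` with the terms cleared of
denominators, for the Blaschke product `B(z) = z (z - f) (z - g) / ((1 - f̄ z) (1 - ḡ z))`
(`isBlaschkeTriple_of_tangent`). Hence the triangles of the family are exactly the fibres `B = l`,
`|l| = 1`: by the maximum principle and the positivity of the angular derivative of `B`, each
fibre consists of three distinct points of the unit circle.

The elementary symmetric functions of a fibre are real affine in `l`. The circumcircle of the
corresponding triangle of `E` cuts the unit circle, in the affine coordinate, in the fibre and in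
`l̄`, so its center `X` and the power `w` of `O` with respect to it are real affine functions of `l`
as well. The circumcenter of the inversive triangle is `O + r² (X - O) / w`
(`IsInversiveTriangle.circumcenter_eq`), and the power vanishes exactly when no inversive triangle
exists. The locus is therefore the affine part of the image of the unit circle under a projective
map, and a nondegenerate conic if this map is invertible (`isNondegenerateConic_of_projective`).

Invertibility means that `X - O` and `w` do not vanish together, not even for parameters `l` off
the unit circle or at infinity. At infinity it follows from `a ≠ b` and `|f g| < 1`. At a finite
parameter with `X = O` the power is minus the squared radius, extended by its affine formula in
`l`; this radius is nonzero because it is a weighted mean, with positive weights, of the squared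
distances from `X` to the vertices of one fixed triangle of the family
(`Ellipse.ponceletRadiusSq_pos`). The weights are those of a Clark measure of `B`, and the identity
behind the mean is Lagrange interpolation at the three points of the fibre.
-/

open scoped ComplexConjugate

/-! ### The Blaschke product with zeros `0`, `f`, `g` -/

theorem norm_one_sub_conj_mul_sq_sub (f z : ℂ) :
    ‖1 - conj f * z‖ ^ 2 - ‖z - f‖ ^ 2 = (1 - ‖z‖ ^ 2) * (1 - ‖f‖ ^ 2) := by
  simp only [Complex.sq_norm, Complex.normSq_apply, Complex.sub_re, Complex.sub_im, Complex.mul_re,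
    Complex.mul_im, Complex.conj_re, Complex.conj_im, Complex.one_re, Complex.one_im]
  ring

theorem conj_mul_self_of_norm_eq_one {z : ℂ} (hz : ‖z‖ = 1) : conj z * z = 1 := by
  rw [mul_comm, Complex.mul_conj, Complex.normSq_eq_norm_sq, hz]; simp

theorem norm_eq_one_of_blaschke_eq {f g l z : ℂ} (hf : ‖f‖ < 1) (hg : ‖g‖ < 1) (hl : ‖l‖ = 1)
    (h : z * (z - f) * (z - g) = l * ((1 - conj f * z) * (1 - conj g * z))) : ‖z‖ = 1 := by
  have hn : ‖z‖ * ‖z - f‖ * ‖z - g‖ = ‖1 - conj f * z‖ * ‖1 - conj g * z‖ := by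
    have := congrArg norm h
    simpa [hl] using this
  have key : ∀ e : ℂ, ‖e‖ < 1 → (‖z‖ < 1 → ‖z - e‖ < ‖1 - conj e * z‖) ∧
      (1 < ‖z‖ → ‖1 - conj e * z‖ < ‖z - e‖) := by
    intro e he
    have h1 := norm_one_sub_conj_mul_sq_sub e z
    have h2 : 0 < 1 - ‖e‖ ^ 2 := by nlinarith [norm_nonneg e]
    refine ⟨fun h => ?_, fun h => ?_⟩
    · have h3 : 0 < 1 - ‖z‖ ^ 2 := by nlinarith [norm_nonneg z]
      exact lt_of_pow_lt_pow_left₀ 2 (norm_nonneg _) (by nlinarith [mul_pos h3 h2])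
    · have h3 : 0 < ‖z‖ ^ 2 - 1 := by nlinarith
      exact lt_of_pow_lt_pow_left₀ 2 (norm_nonneg _) (by nlinarith [mul_pos h3 h2])
  rcases lt_trichotomy ‖z‖ 1 with h1 | h1 | h1
  · have hF := (key f hf).1 h1
    have hG := (key g hg).1 h1
    have : ‖z‖ * ‖z - f‖ * ‖z - g‖ < ‖1 - conj f * z‖ * ‖1 - conj g * z‖ :=
      mul_lt_mul'' (by nlinarith [norm_nonneg (z - f)]) hG (by positivity) (by positivity)
    exact absurd hn this.ne
  · exact h1
  · have hF := (key f hf).2 h1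
    have hG := (key g hg).2 h1
    have : ‖1 - conj f * z‖ * ‖1 - conj g * z‖ < ‖z‖ * ‖z - f‖ * ‖z - g‖ :=
      mul_lt_mul'' (by nlinarith [norm_nonneg (1 - conj f * z)]) hG (by positivity) (by positivity)
    exact absurd hn this.ne'

/-- `IsBlaschkeTriple f g l z₁ z₂ z₃` says that `z₁, z₂, z₃` are the roots, with multiplicity, of
`z (z - f) (z - g) = l (1 - f̄ z) (1 - ḡ z)`, in terms of their elementary symmetric functions. -/
structure IsBlaschkeTriple (f g l z₁ z₂ z₃ : ℂ) : Prop where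
  sum : z₁ + z₂ + z₃ = f + g + l * conj (f * g)
  sum_mul : z₁ * z₂ + z₂ * z₃ + z₃ * z₁ = f * g + l * conj (f + g)
  prod : z₁ * z₂ * z₃ = l

namespace IsBlaschkeTriple

variable {f g l z₁ z₂ z₃ : ℂ}

theorem sub_eq_prod (h : IsBlaschkeTriple f g l z₁ z₂ z₃) (z : ℂ) :
    z * (z - f) * (z - g) - l * ((1 - conj f * z) * (1 - conj g * z)) =
      (z - z₁) * (z - z₂) * (z - z₃) := by
  have h1 := h.sum
  have h2 := h.sum_mul
  have h3 := h.prod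
  simp only [map_mul, map_add] at h1 h2
  linear_combination z ^ 2 * h1 - z * h2 + h3

theorem rotate (h : IsBlaschkeTriple f g l z₁ z₂ z₃) : IsBlaschkeTriple f g l z₂ z₃ z₁ :=
  ⟨by rw [← h.sum]; ring, by rw [← h.sum_mul]; ring, by rw [← h.prod]; ring⟩

theorem blaschke_eq (h : IsBlaschkeTriple f g l z₁ z₂ z₃) :
    z₁ * (z₁ - f) * (z₁ - g) = l * ((1 - conj f * z₁) * (1 - conj g * z₁)) := by
  have := h.sub_eq_prod z₁
  rw [sub_self, zero_mul, zero_mul] at this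
  exact sub_eq_zero.1 this

theorem norm_eq_one (h : IsBlaschkeTriple f g l z₁ z₂ z₃) (hf : ‖f‖ < 1) (hg : ‖g‖ < 1)
    (hl : ‖l‖ = 1) : ‖z₁‖ = 1 :=
  norm_eq_one_of_blaschke_eq hf hg hl h.blaschke_eq

end IsBlaschkeTriple

theorem exists_isBlaschkeTriple (f g l : ℂ) : ∃ z₁ z₂ z₃, IsBlaschkeTriple f g l z₁ z₂ z₃ := by
  let P : Cubic ℂ := ⟨1, -(f + g + l * conj (f * g)), f * g + l * conj (f + g), -l⟩
  have ha : P.a ≠ 0 := one_ne_zero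
  obtain ⟨x, y, z, h⟩ := (Cubic.splits_iff_roots_eq_three (φ := RingHom.id ℂ) ha).1
    (IsAlgClosed.splits _)
  have hb := Cubic.b_eq_three_roots ha h
  have hc := Cubic.c_eq_three_roots ha h
  have hd := Cubic.d_eq_three_roots ha h
  simp only [RingHom.id_apply, P] at hb hc hd
  exact ⟨x, y, z, by linear_combination hb, by linear_combination -hc, by linear_combination hd⟩

theorem one_sub_conj_mul_ne_zero {f z : ℂ} (hf : ‖f‖ < 1) (hz : ‖z‖ = 1) :
    1 - conj f * z ≠ 0 := by
  intro h
  have := congrArg norm (sub_eq_zero.1 h)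
  simp [hz] at this
  linarith

theorem sub_ne_zero_of_norm {f z : ℂ} (hf : ‖f‖ < 1) (hz : ‖z‖ = 1) : z - f ≠ 0 := by
  rw [sub_ne_zero]; rintro rfl; linarith

/-- The angular derivative `z B'(z) / B(z)` on the unit circle of the Blaschke product `B` with
zeros `0`, `f`, `g`, as a sum of Poisson kernels. -/
noncomputable def blaschkeSpeed (f g z : ℂ) : ℝ :=
  1 + (1 - ‖f‖ ^ 2) / ‖z - f‖ ^ 2 + (1 - ‖g‖ ^ 2) / ‖z - g‖ ^ 2

theorem blaschkeSpeed_pos {f g : ℂ} (hf : ‖f‖ < 1) (hg : ‖g‖ < 1) (z : ℂ) :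
    0 < blaschkeSpeed f g z := by
  have h1 : 0 ≤ 1 - ‖f‖ ^ 2 := by nlinarith [norm_nonneg f]
  have h2 : 0 ≤ 1 - ‖g‖ ^ 2 := by nlinarith [norm_nonneg g]
  unfold blaschkeSpeed
  positivity

theorem poisson_kernel_eq {f z : ℂ} (hf : ‖f‖ < 1) (hz : ‖z‖ = 1) :
    (((1 - ‖f‖ ^ 2) / ‖z - f‖ ^ 2 : ℝ) : ℂ) =
      z / (z - f) + conj f * z / (1 - conj f * z) := by
  have h1 := one_sub_conj_mul_ne_zero hf hz
  have h2 := sub_ne_zero_of_norm hf hz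
  have h3 := conj_mul_self_of_norm_eq_one hz
  have h4 : conj z - conj f ≠ 0 := by
    rw [← map_sub]; exact (map_ne_zero _).2 h2
  push_cast
  rw [← Complex.mul_conj', ← Complex.mul_conj', map_sub]
  field_simp
  linear_combination (-(1 - f * conj f)) * h3

namespace IsBlaschkeTriple

variable {f g l z₁ z₂ z₃ : ℂ}

/-- The left-hand side is `z₁ N'(z₁)` for the cubic `N = F - l G` with roots `z₁, z₂, z₃`, where
`F / G` is the Blaschke product; `F = l G` at `z₁` turns it into the logarithmic derivative of
`F / G`. -/
theorem mul_sub_mul_sub (h : IsBlaschkeTriple f g l z₁ z₂ z₃) (hf : ‖f‖ < 1) (hg : ‖g‖ < 1)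
    (hz : ‖z₁‖ = 1) :
    z₁ * ((z₁ - z₂) * (z₁ - z₃)) =
      l * ((1 - conj f * z₁) * (1 - conj g * z₁)) * blaschkeSpeed f g z₁ := by
  have h1 := h.sum
  have h2 := h.sum_mul
  have hB := h.blaschke_eq
  simp only [map_mul, map_add] at h1 h2
  have f1 := one_sub_conj_mul_ne_zero hf hz
  have f2 := sub_ne_zero_of_norm hf hz
  have g1 := one_sub_conj_mul_ne_zero hg hz
  have g2 := sub_ne_zero_of_norm hg hz
  unfold blaschkeSpeed
  rw [Complex.ofReal_add, Complex.ofReal_add, poisson_kernel_eq hf hz, poisson_kernel_eq hg hz]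
  have e1 : z₁ * ((z₁ - z₂) * (z₁ - z₃)) =
      z₁ * ((z₁ - f) * (z₁ - g) + z₁ * (z₁ - g) + z₁ * (z₁ - f)
        + l * (conj f * (1 - conj g * z₁) + conj g * (1 - conj f * z₁))) := by
    linear_combination -2 * z₁ ^ 2 * h1 + z₁ * h2
  have e2 : l * ((1 - conj f * z₁) * (1 - conj g * z₁)) *
      (((1 : ℝ) : ℂ) + (z₁ / (z₁ - f) + conj f * z₁ / (1 - conj f * z₁)) +
        (z₁ / (z₁ - g) + conj g * z₁ / (1 - conj g * z₁))) =
      z₁ * (z₁ - f) * (z₁ - g) * (1 + z₁ / (z₁ - f) + z₁ / (z₁ - g)) +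
      l * ((1 - conj f * z₁) * (1 - conj g * z₁)) *
        (conj f * z₁ / (1 - conj f * z₁) + conj g * z₁ / (1 - conj g * z₁)) := by
    rw [hB]; push_cast; ring
  rw [mul_comm (conj f)] at f1
  rw [mul_comm (conj g)] at g1
  rw [e1, e2]
  field_simp

theorem ne (h : IsBlaschkeTriple f g l z₁ z₂ z₃) (hf : ‖f‖ < 1) (hg : ‖g‖ < 1) (hl : ‖l‖ = 1) :
    z₁ ≠ z₂ := by
  rintro rfl
  have hz := h.norm_eq_one hf hg hl
  have h1 := h.mul_sub_mul_sub hf hg hz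
  rw [sub_self, zero_mul, mul_zero] at h1
  have hl0 : l ≠ 0 := by rintro rfl; simp at hl
  have h3 : (blaschkeSpeed f g z₁ : ℂ) ≠ 0 :=
    Complex.ofReal_ne_zero.2 (blaschkeSpeed_pos hf hg _).ne'
  exact mul_ne_zero (mul_ne_zero hl0 (mul_ne_zero (one_sub_conj_mul_ne_zero hf hz)
    (one_sub_conj_mul_ne_zero hg hz))) h3 h1.symm

end IsBlaschkeTriple

/-! ### The real trigonometric polynomial of the circumcircles -/

/-- On the unit circle, the trigonometric polynomial `z² - s z + t - s̄ z̄ + z̄²` with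
`s = f + g + l f̄ ḡ + l̄` and `t = 2 Re (f g + l̄ (f + g))`. For `|l| = 1` it vanishes at the
Blaschke triple of parameter `l` and at `l̄`. -/
noncomputable def circlePoly (f g l z : ℂ) : ℝ :=
  2 * (z ^ 2 - (f + g + l * conj (f * g) + conj l) * z + (f * g + conj l * (f + g))).re

theorem circlePoly_eq {f g l z : ℂ} (hz : ‖z‖ = 1) :
    z ^ 2 * (circlePoly f g l z : ℂ) = z * (z - f) * (z - g) * (z - conj l) +
      (1 - conj f * z) * (1 - conj g * z) * (1 - l * z) := by
  have h3 := conj_mul_self_of_norm_eq_one hz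
  unfold circlePoly
  rw [Complex.ofReal_mul, Complex.ofReal_ofNat, Complex.re_eq_add_conj]
  simp only [map_add, map_sub, map_mul, map_pow, Complex.conj_conj]
  linear_combination (conj z * z + 1 - (conj f + conj g + conj l * (f * g) + l) * z) * h3

theorem IsBlaschkeTriple.circlePoly_eq_zero {f g l z₁ z₂ z₃ : ℂ}
    (h : IsBlaschkeTriple f g l z₁ z₂ z₃) (hl : ‖l‖ = 1) (hz : ‖z₁‖ = 1) :
    circlePoly f g l z₁ = 0 := by
  have hz0 : z₁ ≠ 0 := by rintro rfl; simp at hz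
  have h1 := circlePoly_eq (f := f) (g := g) (l := l) hz
  have h2 := h.blaschke_eq
  have h3 := conj_mul_self_of_norm_eq_one hl
  have h4 : z₁ ^ 2 * (circlePoly f g l z₁ : ℂ) = 0 := by
    rw [h1]
    linear_combination (z₁ - conj l) * h2 - ((1 - conj f * z₁) * (1 - conj g * z₁)) * h3
  exact Complex.ofReal_eq_zero.1 ((mul_eq_zero.1 h4).resolve_left (pow_ne_zero _ hz0))

/-- A positive weight at each point of a Blaschke triple: the mass there of the Clark measure of
the Blaschke product, divided by `|G|²` for `G = (1 - f̄ z) (1 - ḡ z)`. -/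
noncomputable def clarkWeight (f g z : ℂ) : ℝ :=
  (‖(1 - conj f * z) * (1 - conj g * z)‖ ^ 2 * blaschkeSpeed f g z)⁻¹

theorem clarkWeight_pos {f g z : ℂ} (hf : ‖f‖ < 1) (hg : ‖g‖ < 1) (hz : ‖z‖ = 1) :
    0 < clarkWeight f g z := by
  have := norm_pos_iff.2 (mul_ne_zero (one_sub_conj_mul_ne_zero hf hz)
    (one_sub_conj_mul_ne_zero hg hz))
  have := blaschkeSpeed_pos hf hg z
  unfold clarkWeight
  positivity

/-- Up to the factor `(z₁ - z₂) (z₁ - z₃)`, the weighted value of `circlePoly` at `z₁` is an affine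
function of `z₁` whose coefficients do not depend on the point of the triple. -/
theorem IsBlaschkeTriple.clarkWeight_mul_circlePoly {f g l z₁ z₂ z₃ : ℂ}
    (h : IsBlaschkeTriple f g l z₁ z₂ z₃) (hf : ‖f‖ < 1) (hg : ‖g‖ < 1) (hl : ‖l‖ = 1) (k : ℂ) :
    ((clarkWeight f g z₁ * circlePoly f g k z₁ : ℝ) : ℂ) * ((z₁ - z₂) * (z₁ - z₃)) =
      (1 - l * conj k) + (l - k) * z₁ := by
  have hz := h.norm_eq_one hf hg hl
  have hz0 : z₁ ≠ 0 := by rintro rfl; simp at hz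
  have hG : (1 - conj f * z₁) * (1 - conj g * z₁) ≠ 0 :=
    mul_ne_zero (one_sub_conj_mul_ne_zero hf hz) (one_sub_conj_mul_ne_zero hg hz)
  have hz' := conj_mul_self_of_norm_eq_one hz
  have hB := h.blaschke_eq
  have hT := circlePoly_eq (f := f) (g := g) (l := k) hz
  rw [hB] at hT
  have hN := h.mul_sub_mul_sub hf hg hz
  -- On the unit circle `z² * conj G = (z - f) (z - g)`, so `z³ |G|² = F G` with `F = l G`.
  have hGG : z₁ ^ 3 * ((‖(1 - conj f * z₁) * (1 - conj g * z₁)‖ : ℂ) ^ 2) =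
      l * ((1 - conj f * z₁) * (1 - conj g * z₁)) ^ 2 := by
    have : z₁ ^ 2 * conj ((1 - conj f * z₁) * (1 - conj g * z₁)) = (z₁ - f) * (z₁ - g) := by
      simp only [map_mul, map_sub, map_one, Complex.conj_conj]
      linear_combination (-f * z₁ - g * z₁ + f * g * (conj z₁ * z₁ + 1)) * hz'
    rw [← Complex.mul_conj']
    linear_combination z₁ * ((1 - conj f * z₁) * (1 - conj g * z₁)) * this +
      ((1 - conj f * z₁) * (1 - conj g * z₁)) * hB
  have hρ : (blaschkeSpeed f g z₁ : ℂ) ≠ 0 :=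
    Complex.ofReal_ne_zero.2 (blaschkeSpeed_pos hf hg _).ne'
  unfold clarkWeight
  push_cast
  set G := (1 - conj f * z₁) * (1 - conj g * z₁)
  have hn : (‖G‖ : ℂ) ≠ 0 := Complex.ofReal_ne_zero.2 (norm_ne_zero_iff.2 hG)
  field_simp
  apply mul_left_cancel₀ (pow_ne_zero 3 hz0)
  linear_combination (z₁ * ((z₁ - z₂) * (z₁ - z₃))) * hT +
    G * ((1 - l * conj k) + (l - k) * z₁) * hN -
    blaschkeSpeed f g z₁ * ((1 - l * conj k) + (l - k) * z₁) * hGG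

/-- The weighted sum of the values of `circlePoly` over a Blaschke triple is zero, also when the
parameter of the polynomial is not the one of the triple and not of modulus one. -/
theorem IsBlaschkeTriple.sum_clarkWeight_mul_circlePoly {f g l z₁ z₂ z₃ : ℂ}
    (h : IsBlaschkeTriple f g l z₁ z₂ z₃) (hf : ‖f‖ < 1) (hg : ‖g‖ < 1) (hl : ‖l‖ = 1) (k : ℂ) :
    clarkWeight f g z₁ * circlePoly f g k z₁ + clarkWeight f g z₂ * circlePoly f g k z₂ +
      clarkWeight f g z₃ * circlePoly f g k z₃ = 0 := by
  have h12 := sub_ne_zero.2 (h.ne hf hg hl)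
  have h23 := sub_ne_zero.2 (h.rotate.ne hf hg hl)
  have h31 := sub_ne_zero.2 (h.rotate.rotate.ne hf hg hl)
  have e1 := h.clarkWeight_mul_circlePoly hf hg hl k
  have e2 := h.rotate.clarkWeight_mul_circlePoly hf hg hl k
  have e3 := h.rotate.rotate.clarkWeight_mul_circlePoly hf hg hl k
  rw [← Complex.ofReal_eq_zero, Complex.ofReal_add, Complex.ofReal_add]
  apply mul_right_cancel₀ (mul_ne_zero (mul_ne_zero h12 h23) h31)
  linear_combination -(z₂ - z₃) * e1 - (z₃ - z₁) * e2 - (z₁ - z₂) * e3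

/-! ### Chords of the unit circle tangent to an ellipse -/

/-- The chord through `z` and `w` on the unit circle has equation `x + z w x̄ = z + w`; the
condition is that it meets the ellipse `u ↦ c + α u + β ū` once. Substituting gives a quadratic
equation for `u` whose two roots are both on the unit circle as soon as one of them is, and the
condition is that its discriminant vanishes. -/
theorem existsUnique_mem_chord_iff {c α β z w : ℂ} (hαβ : ‖α‖ ≠ ‖β‖) (hz : ‖z‖ = 1)
    (hw : ‖w‖ = 1) :
    (∃! u : ℂ, ‖u‖ = 1 ∧
      (c + α * u + β * conj u) + z * w * conj (c + α * u + β * conj u) = z + w) ↔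
    (z + w - c - conj c * (z * w)) ^ 2 =
      4 * ((α + conj β * (z * w)) * (β + conj α * (z * w))) := by
  have hz' := conj_mul_self_of_norm_eq_one hz
  have hw' := conj_mul_self_of_norm_eq_one hw
  obtain ⟨q, hq⟩ : ∃ q, q = z * w := ⟨_, rfl⟩
  obtain ⟨A, hA⟩ : ∃ A, A = α + conj β * q := ⟨_, rfl⟩
  obtain ⟨D, hD⟩ : ∃ D, D = z + w - c - conj c * q := ⟨_, rfl⟩
  have hq1 : ‖q‖ = 1 := by rw [hq, norm_mul, hz, hw, one_mul]
  have hq' := conj_mul_self_of_norm_eq_one hq1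
  have hA0 : A ≠ 0 := by
    intro h
    apply hαβ
    have : α = -(conj β * q) := by rw [h] at hA; linear_combination -hA
    rw [this, norm_neg, norm_mul, hq1, mul_one, RCLike.norm_conj]
  have hqA : β + conj α * q = q * conj A := by
    rw [hA]; simp only [map_add, map_mul, Complex.conj_conj]; linear_combination -β * hq'
  have hDD : q * conj D = D := by
    rw [hD, hq]; simp only [map_sub, map_add, map_mul, Complex.conj_conj]
    linear_combination (w - c * conj w * w) * hz' + (z - c) * hw'
  have hline : ∀ u : ℂ, (c + α * u + β * conj u) + z * w * conj (c + α * u + β * conj u) = z + w ↔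
      A * u + q * conj A * conj u = D := by
    intro u
    rw [← hqA, hA, hD, ← hq]
    simp only [map_add, map_mul, Complex.conj_conj]
    constructor <;> intro h <;> linear_combination h
  simp only [hline]
  rw [← hq, ← hA, ← hD, hqA]
  have hAc0 : conj A ≠ 0 := (map_ne_zero _).2 hA0
  constructor
  · rintro ⟨u, ⟨hu, hu'⟩, huniq⟩
    have hu1 := conj_mul_self_of_norm_eq_one hu
    -- The other root of the quadratic equation, as the product of the roots is `q * conj A / A`.
    have key := huniq (q * conj A * conj u / A) ⟨by
        simp only [norm_mul, norm_div, RCLike.norm_conj, hq1, hu]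
        field_simp [norm_ne_zero_iff.2 hA0], by
        simp only [map_div₀, map_mul, Complex.conj_conj]
        field_simp
        linear_combination hu' + A * u * hq'⟩
    have : q * conj A * conj u = u * A := (div_eq_iff hA0).1 key
    rw [← hu']
    linear_combination 4 * A * q * conj A * hu1 + (q * conj A * conj u - A * u) * this
  · intro h
    have hn : ‖D / (2 * A)‖ = 1 := by
      have h1 := congrArg norm h
      simp only [norm_mul, norm_pow, RCLike.norm_conj, hq1, Complex.norm_ofNat, one_mul] at h1
      have h2 : ‖D‖ = 2 * ‖A‖ := by
        rw [← sq_eq_sq₀ (norm_nonneg _) (by positivity)]; linarith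
      rw [norm_div, norm_mul, Complex.norm_ofNat, h2, div_self]
      have := norm_pos_iff.2 hA0
      positivity
    refine ⟨D / (2 * A), ⟨hn, ?_⟩, ?_⟩
    · simp only [map_div₀, map_mul, map_ofNat]
      field_simp
      linear_combination hDD
    · rintro u ⟨hu, hu'⟩
      have hu1 := conj_mul_self_of_norm_eq_one hu
      have : (2 * A * u - D) ^ 2 = 0 := by
        rw [← sub_eq_zero] at h hu'
        linear_combination h + 4 * A * u * hu' - 4 * A * q * conj A * hu1
      rw [eq_div_iff (mul_ne_zero two_ne_zero hA0)]
      linear_combination pow_eq_zero_iff two_ne_zero |>.1 this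

/-- If the chords joining three points of the unit circle are tangent to an ellipse with foci `f`
and `g`, then the three points are the solutions of `B(z) = l` for the Blaschke product `B` with
zeros `0`, `f`, `g`. The last conclusion is a condition on the ellipse alone. -/
theorem isBlaschkeTriple_of_tangent {c α β f g z₁ z₂ z₃ : ℂ} (hfg : f + g = 2 * c)
    (hfg' : f * g = c ^ 2 - 4 * (α * β)) (h0₁ : z₁ ≠ 0) (h0₂ : z₂ ≠ 0)
    (h12 : z₁ ≠ z₂) (h23 : z₂ ≠ z₃) (h31 : z₃ ≠ z₁)
    (t12 : (z₁ + z₂ - c - conj c * (z₁ * z₂)) ^ 2 =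
      4 * ((α + conj β * (z₁ * z₂)) * (β + conj α * (z₁ * z₂))))
    (t23 : (z₂ + z₃ - c - conj c * (z₂ * z₃)) ^ 2 =
      4 * ((α + conj β * (z₂ * z₃)) * (β + conj α * (z₂ * z₃))))
    (t31 : (z₃ + z₁ - c - conj c * (z₃ * z₁)) ^ 2 =
      4 * ((α + conj β * (z₃ * z₁)) * (β + conj α * (z₃ * z₁)))) :
    IsBlaschkeTriple f g (z₁ * z₂ * z₃) z₁ z₂ z₃ ∧
      1 + f * g * conj (f * g) =
        2 * (c * conj c) + 4 * (α * conj α) + 4 * (β * conj β) := by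
  have hs := congrArg conj hfg
  have ht := congrArg conj hfg'
  simp only [map_add, map_sub, map_mul, map_pow, map_ofNat] at hs ht
  obtain ⟨κ, hκ⟩ : ∃ κ, κ = 2 * (c * conj c) - 4 * (α * conj α) - 4 * (β * conj β) := ⟨_, rfl⟩
  -- The tangency condition is quadratic in each point; two roots determine its coefficients.
  have step : ∀ x y y' : ℂ, y ≠ y' →
      (x + y - c - conj c * (x * y)) ^ 2 =
        4 * ((α + conj β * (x * y)) * (β + conj α * (x * y))) →
      (x + y' - c - conj c * (x * y')) ^ 2 =
        4 * ((α + conj β * (x * y')) * (β + conj α * (x * y'))) →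
      x * (x - f) * (x - g) = (x * y * y') * ((1 - conj f * x) * (1 - conj g * x)) := by
    intro x y y' hne e e'
    have hL : (1 - conj f * x) * (1 - conj g * x) * (y + y') +
        (2 * x - 2 * c - 2 * conj c * x ^ 2 + κ * x) = 0 := by
      apply mul_left_cancel₀ (sub_ne_zero.2 hne)
      linear_combination e - e' + (y - y') * x * hκ - (y ^ 2 - y' ^ 2) * x * hs +
        (y ^ 2 - y' ^ 2) * x ^ 2 * ht
    linear_combination x * e - x * y * hL + x * y * x * hκ - x * y ^ 2 * x * hs +
        x * y ^ 2 * x ^ 2 * ht - x ^ 2 * hfg + x * hfg'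
  have b1 := step z₁ z₂ z₃ h23 t12 (by linear_combination t31)
  have b2 := step z₂ z₃ z₁ h31 t23 (by linear_combination t12)
  have b3 := step z₃ z₁ z₂ h12 t31 (by linear_combination t23)
  have d12 : z₁ ^ 2 + z₁ * z₂ + z₂ ^ 2 - (f + g + z₁ * z₂ * z₃ * conj (f * g)) * (z₁ + z₂) +
      (f * g + z₁ * z₂ * z₃ * conj (f + g)) = 0 := by
    apply mul_left_cancel₀ (sub_ne_zero.2 h12)
    simp only [map_add, map_mul]
    linear_combination b1 - b2
  have d23 : z₂ ^ 2 + z₂ * z₃ + z₃ ^ 2 - (f + g + z₁ * z₂ * z₃ * conj (f * g)) * (z₂ + z₃) +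
      (f * g + z₁ * z₂ * z₃ * conj (f + g)) = 0 := by
    apply mul_left_cancel₀ (sub_ne_zero.2 h23)
    simp only [map_add, map_mul]
    linear_combination b2 - b3
  have e1 : z₁ + z₂ + z₃ = f + g + z₁ * z₂ * z₃ * conj (f * g) := by
    apply mul_left_cancel₀ (sub_ne_zero.2 h31)
    linear_combination d23 - d12
  refine ⟨⟨e1, by linear_combination (z₁ + z₂) * e1 - d12, rfl⟩, ?_⟩
  apply mul_left_cancel₀ (mul_ne_zero (mul_ne_zero h0₁ h0₂) (sub_ne_zero.2 h12))
  simp only [map_mul]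
  linear_combination (z₁ - z₂) * t12 - ((1 - conj f * z₂) * (1 - conj g * z₂)) * b1 +
    ((1 - conj f * z₁) * (1 - conj g * z₁)) * b2 -
    (z₁ - z₂) * ((z₁ + z₂ - z₁ * z₂ * (conj f + conj g)) * hfg +
      ((z₁ + z₂) * (z₁ * z₂) - 2 * c * (z₁ * z₂)) * hs - hfg' - (z₁ * z₂) ^ 2 * ht)

/-- The converse of `isBlaschkeTriple_of_tangent`. -/
theorem IsBlaschkeTriple.tangent {c α β f g l z₁ z₂ z₃ : ℂ} (hfg : f + g = 2 * c)
    (hfg' : f * g = c ^ 2 - 4 * (α * β)) (h : IsBlaschkeTriple f g l z₁ z₂ z₃)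
    (h12 : z₁ ≠ z₂)
    (hc : 1 + f * g * conj (f * g) =
      2 * (c * conj c) + 4 * (α * conj α) + 4 * (β * conj β)) :
    (z₁ + z₂ - c - conj c * (z₁ * z₂)) ^ 2 =
      4 * ((α + conj β * (z₁ * z₂)) * (β + conj α * (z₁ * z₂))) := by
  have hs := congrArg conj hfg
  have ht := congrArg conj hfg'
  have b1 := h.blaschke_eq
  have b2 := h.rotate.blaschke_eq
  simp only [map_add, map_sub, map_mul, map_pow, map_ofNat] at hs ht hc
  apply mul_left_cancel₀ (sub_ne_zero.2 h12)
  linear_combination ((1 - conj f * z₂) * (1 - conj g * z₂)) * b1 -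
    ((1 - conj f * z₁) * (1 - conj g * z₁)) * b2 +
    (z₁ - z₂) * (z₁ * z₂) * hc +
    (z₁ - z₂) * ((z₁ + z₂ - z₁ * z₂ * (conj f + conj g)) * hfg +
      ((z₁ + z₂) * (z₁ * z₂) - 2 * c * (z₁ * z₂)) * hs - hfg' - (z₁ * z₂) ^ 2 * ht)

/-! ### Projective images of the unit circle -/

/-- The image of the unit circle under an invertible projective map, without its points at
infinity, is a nondegenerate conic. -/
theorem isNondegenerateConic_of_projective {S : Set ℂ} (P : Matrix (Fin 3) (Fin 3) ℝ)
    (hP : P.det ≠ 0)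
    (hS : ∀ z, z ∈ S ↔ ∃ l : ℂ, ‖l‖ = 1 ∧ ∃ t : ℝ, t ≠ 0 ∧
      P.mulVec ![l.re, l.im, 1] = t • ![z.re, z.im, 1]) :
    IsNondegenerateConic S := by
  have hPu : IsUnit P.det := isUnit_iff_ne_zero.2 hP
  constructor
  · by_contra hne
    rw [Set.not_nonempty_iff_eq_empty] at hne
    -- A set without affine points means that the third coordinate vanishes on the whole circle.
    have hrow : ∀ l : ℂ, ‖l‖ = 1 → P 2 0 * l.re + P 2 1 * l.im + P 2 2 = 0 := by
      intro l hl
      by_contra ht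
      set t := P 2 0 * l.re + P 2 1 * l.im + P 2 2 with htdef
      set p := P.mulVec ![l.re, l.im, 1] with hp
      have : (⟨p 0 / t, p 1 / t⟩ : ℂ) ∈ S := by
        refine (hS _).2 ⟨l, hl, t, ht, ?_⟩
        rw [← hp]
        ext i
        fin_cases i
        · simp; field_simp
        · simp; field_simp
        · simp [hp, htdef, Matrix.mulVec, dotProduct, Fin.sum_univ_three]
      rw [hne] at this
      exact this
    have h1 := hrow 1 (by simp)
    have h2 := hrow (-1) (by simp)
    have h3 := hrow Complex.I (by simp)
    simp at h1 h2 h3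
    apply hP
    apply Matrix.det_eq_zero_of_row_eq_zero 2
    intro j
    fin_cases j <;> simp <;> linarith
  · have hD : (Matrix.diagonal ![(1 : ℝ), 1, -1]).det ≠ 0 := by
      simp [Matrix.det_diagonal, Fin.prod_univ_three]
    refine ⟨P⁻¹.transpose * Matrix.diagonal ![1, 1, -1] * P⁻¹, ?_, ?_, ?_⟩
    · unfold Matrix.IsSymm
      simp [Matrix.transpose_mul, Matrix.mul_assoc]
    · have : P⁻¹.det ≠ 0 := by
        rw [Matrix.det_nonsing_inv]; simpa using hP
      rw [Matrix.det_mul, Matrix.det_mul, Matrix.det_transpose]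
      exact mul_ne_zero (mul_ne_zero this hD) this
    · have form : ∀ v : Fin 3 → ℝ, dotProduct v
          ((P⁻¹.transpose * Matrix.diagonal ![1, 1, -1] * P⁻¹).mulVec v) =
          (P⁻¹.mulVec v 0) ^ 2 + (P⁻¹.mulVec v 1) ^ 2 - (P⁻¹.mulVec v 2) ^ 2 := by
        intro v
        rw [← Matrix.mulVec_mulVec, ← Matrix.mulVec_mulVec, Matrix.dotProduct_mulVec,
          Matrix.vecMul_transpose]
        simp [dotProduct, Fin.sum_univ_three, Matrix.mulVec_diagonal]
        ring
      ext z
      rw [hS, Set.mem_ofPred_eq, form]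
      constructor
      · rintro ⟨l, hl, t, ht, h⟩
        have h' : P⁻¹.mulVec ![z.re, z.im, 1] = t⁻¹ • ![l.re, l.im, 1] := by
          rw [eq_inv_smul_iff₀ ht, ← Matrix.mulVec_smul, ← h, Matrix.mulVec_mulVec,
            Matrix.nonsing_inv_mul _ hPu, Matrix.one_mulVec]
        have hl' : l.re * l.re + l.im * l.im = 1 := by
          rw [← Complex.normSq_apply, Complex.normSq_eq_norm_sq, hl, one_pow]
        rw [h']
        simp
        linear_combination t⁻¹ ^ 2 * hl'
      · intro h
        obtain ⟨v, hv⟩ : ∃ v, v = P⁻¹.mulVec ![z.re, z.im, 1] := ⟨_, rfl⟩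
        rw [← hv] at h
        have hPv : P.mulVec v = ![z.re, z.im, 1] := by
          rw [hv, Matrix.mulVec_mulVec, Matrix.mul_nonsing_inv _ hPu, Matrix.one_mulVec]
        have h2 : v 2 ≠ 0 := by
          intro h2
          rw [h2] at h
          have h0 : v 0 = 0 := by nlinarith [sq_nonneg (v 0), sq_nonneg (v 1)]
          have h1 : v 1 = 0 := by nlinarith [sq_nonneg (v 0), sq_nonneg (v 1)]
          have : v = 0 := by ext i; fin_cases i <;> simp [h0, h1, h2]
          have h3 := congrFun hPv 2
          rw [this] at h3
          simp at h3
        refine ⟨⟨v 0 / v 2, v 1 / v 2⟩, ?_, (v 2)⁻¹, inv_ne_zero h2, ?_⟩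
        · rw [← sq_eq_sq₀ (norm_nonneg _) zero_le_one, ← Complex.normSq_eq_norm_sq,
            Complex.normSq_apply]
          field_simp
          linarith
        · rw [← hPv, ← Matrix.mulVec_smul]
          congr 1
          ext i
          fin_cases i <;> simp [h2, div_eq_inv_mul]

/-- The hypotheses `hlin` and `haff` say that the real-linear map
`(l, k) ↦ (k y₀ + l y₁ + l̄ y₂, k w₀ + Re (w₁ l))` on `ℂ × ℝ` has trivial kernel. -/
theorem isNondegenerateConic_of_unitCircle (O y₀ y₁ y₂ w₁ : ℂ) (w₀ : ℝ)
    (hlin : ∀ l : ℂ, l * y₁ + conj l * y₂ = 0 → l = 0)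
    (haff : ∀ l : ℂ, y₀ + l * y₁ + conj l * y₂ = 0 → w₀ + (w₁ * l).re ≠ 0) :
    IsNondegenerateConic {z | ∃ l : ℂ, ‖l‖ = 1 ∧ w₀ + (w₁ * l).re ≠ 0 ∧
      z = O + (y₀ + l * y₁ + conj l * y₂) / ((w₀ + (w₁ * l).re : ℝ) : ℂ)} := by
  let P : Matrix (Fin 3) (Fin 3) ℝ :=
    !![y₁.re + y₂.re + O.re * w₁.re, y₂.im - y₁.im - O.re * w₁.im, y₀.re + O.re * w₀;
       y₁.im + y₂.im + O.im * w₁.re, y₁.re - y₂.re - O.im * w₁.im, y₀.im + O.im * w₀;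
       w₁.re, -w₁.im, w₀]
  have hPv : ∀ a b c : ℝ, P.mulVec ![a, b, c] =
      ![(y₁.re + y₂.re + O.re * w₁.re) * a + (y₂.im - y₁.im - O.re * w₁.im) * b +
          (y₀.re + O.re * w₀) * c,
        (y₁.im + y₂.im + O.im * w₁.re) * a + (y₁.re - y₂.re - O.im * w₁.im) * b +
          (y₀.im + O.im * w₀) * c,
        w₁.re * a - w₁.im * b + w₀ * c] := by
    intro a b c
    ext i
    fin_cases i
    all_goals
      simp [P, Matrix.mulVec, dotProduct, Fin.sum_univ_three]
      try ring
  apply isNondegenerateConic_of_projective P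
  · intro hdet
    obtain ⟨v, hv0, hv⟩ := Matrix.exists_mulVec_eq_zero_iff.2 hdet
    apply hv0
    have hve : v = ![v 0, v 1, v 2] := by ext i; fin_cases i <;> rfl
    rw [hve, hPv] at hv
    have e0 := congrFun hv 0
    have e1 := congrFun hv 1
    have e2 := congrFun hv 2
    simp at e0 e1 e2
    by_cases h2 : v 2 = 0
    · have := hlin ⟨v 0, v 1⟩ (by
        apply Complex.ext <;> simp
        · rw [h2] at e0 e2; linear_combination e0 - O.re * e2
        · rw [h2] at e1 e2; linear_combination e1 - O.im * e2)
      have h0 := congrArg Complex.re this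
      have h1 := congrArg Complex.im this
      simp at h0 h1
      ext i; fin_cases i <;> simp [h0, h1, h2]
    · exfalso
      refine haff ⟨v 0 / v 2, v 1 / v 2⟩ ?_ ?_
      · apply Complex.ext <;> (simp; field_simp)
        · linear_combination e0 - O.re * e2
        · linear_combination e1 - O.im * e2
      · simp
        field_simp
        linear_combination e2
  · intro z
    have hl : ∀ (l : ℂ) (t : ℝ), t ≠ 0 → (P.mulVec ![l.re, l.im, 1] = t • ![z.re, z.im, 1] ↔
        w₀ + (w₁ * l).re = t ∧ z = O + (y₀ + l * y₁ + conj l * y₂) / (t : ℂ)) := by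
      intro l t ht
      have ht' : (t : ℂ) ≠ 0 := Complex.ofReal_ne_zero.2 ht
      have : z = O + (y₀ + l * y₁ + conj l * y₂) / (t : ℂ) ↔
          t * z = t * O + (y₀ + l * y₁ + conj l * y₂) := by
        constructor
        · rintro rfl; field_simp
        · intro h; field_simp; linear_combination h
      rw [hPv, this]
      constructor
      · intro h
        have e0 := congrFun h 0
        have e1 := congrFun h 1
        have e2 := congrFun h 2
        simp at e0 e1 e2
        refine ⟨by simp; linear_combination e2, ?_⟩
        apply Complex.ext <;> simp
        · linear_combination -e0 + O.re * e2
        · linear_combination -e1 + O.im * e2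
      · rintro ⟨h2, h⟩
        have h0 := congrArg Complex.re h
        have h1 := congrArg Complex.im h
        simp at h0 h1 h2
        ext i
        fin_cases i <;> simp
        · linear_combination -h0 + O.re * h2
        · linear_combination -h1 + O.im * h2
        · linear_combination h2
    rw [Set.mem_ofPred_eq]
    refine exists_congr fun l => and_congr_right fun _ => ⟨fun h => ?_, ?_⟩
    · exact ⟨_, h.1, (hl l _ h.1).2 ⟨rfl, h.2⟩⟩
    · rintro ⟨t, ht, h⟩
      obtain ⟨rfl, h'⟩ := (hl l t ht).1 h
      exact ⟨ht, h'⟩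

/-! ### Affine normalisation of an ellipse to the unit circle -/

namespace Ellipse

variable (E : Ellipse)

/-- The affine map taking the unit circle to the ellipse and the unit disc to its interior; in the
frame of the ellipse it is `x + i y ↦ a x + i b y`. -/
noncomputable def param (ζ : ℂ) : ℂ :=
  E.center + E.dir * ((((E.a + E.b) / 2 : ℝ) : ℂ) * ζ + (((E.a - E.b) / 2 : ℝ) : ℂ) * conj ζ)

theorem conj_dir_mul_dir : conj E.dir * E.dir = 1 :=
  conj_mul_self_of_norm_eq_one E.norm_dir

theorem dir_ne_zero : E.dir ≠ 0 := by
  intro h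
  have := E.norm_dir
  rw [h] at this
  simp at this

theorem coord_param (ζ : ℂ) : E.coord (E.param ζ) = ⟨E.a * ζ.re, E.b * ζ.im⟩ := by
  have : E.coord (E.param ζ) =
      (((E.a + E.b) / 2 : ℝ) : ℂ) * ζ + (((E.a - E.b) / 2 : ℝ) : ℂ) * conj ζ := by
    unfold coord param
    linear_combination ((((E.a + E.b) / 2 : ℝ) : ℂ) * ζ +
      (((E.a - E.b) / 2 : ℝ) : ℂ) * conj ζ) * E.conj_dir_mul_dir
  rw [this]
  apply Complex.ext <;> simp <;> ring

theorem sum_sq_coord_param (ζ : ℂ) :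
    ((E.coord (E.param ζ)).re / E.a) ^ 2 + ((E.coord (E.param ζ)).im / E.b) ^ 2 = ‖ζ‖ ^ 2 := by
  have ha := E.a_pos.ne'
  have hb := E.b_pos.ne'
  rw [coord_param, ← Complex.normSq_eq_norm_sq, Complex.normSq_apply]
  field_simp

theorem param_mem_curve_iff (ζ : ℂ) : E.param ζ ∈ E.curve ↔ ‖ζ‖ = 1 := by
  unfold curve
  rw [Set.mem_ofPred_eq, sum_sq_coord_param, pow_eq_one_iff_of_nonneg (norm_nonneg _) two_ne_zero]

theorem param_mem_inside_iff (ζ : ℂ) : E.param ζ ∈ E.inside ↔ ‖ζ‖ < 1 := by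
  unfold inside
  rw [Set.mem_ofPred_eq, sum_sq_coord_param, sq_lt_one_iff₀ (norm_nonneg _)]

theorem param_injective : Function.Injective E.param := by
  intro z w h
  have h' := congrArg E.coord h
  rw [coord_param, coord_param, Complex.mk.injEq] at h'
  exact Complex.ext (mul_left_cancel₀ E.a_pos.ne' h'.1) (mul_left_cancel₀ E.b_pos.ne' h'.2)

theorem param_surjective : Function.Surjective E.param := by
  intro z
  refine ⟨⟨(E.coord z).re / E.a, (E.coord z).im / E.b⟩, ?_⟩
  have h : ∀ x y : ℂ, E.coord x = E.coord y → x = y := by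
    intro x y hxy
    unfold coord at hxy
    have := mul_left_cancel₀ ((map_ne_zero _).2 E.dir_ne_zero) hxy
    linear_combination this
  apply h
  rw [coord_param]
  have ha := E.a_pos.ne'
  have hb := E.b_pos.ne'
  apply Complex.ext <;> simp <;> field_simp

theorem exists_param_eq_of_mem_curve {z : ℂ} (hz : z ∈ E.curve) :
    ∃ ζ, ‖ζ‖ = 1 ∧ E.param ζ = z := by
  obtain ⟨ζ, rfl⟩ := E.param_surjective z
  exact ⟨ζ, (E.param_mem_curve_iff ζ).1 hz, rfl⟩

theorem param_lineMap (z w : ℂ) (t : ℝ) :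
    E.param (AffineMap.lineMap z w t) = AffineMap.lineMap (E.param z) (E.param w) t := by
  simp only [AffineMap.lineMap_apply, vsub_eq_sub, vadd_eq_add, param, Complex.real_smul, map_add,
    map_mul, map_sub, Complex.conj_ofReal]
  ring

theorem param_mem_affineSpan_pair_iff (x z w : ℂ) :
    E.param x ∈ affineSpan ℝ {E.param z, E.param w} ↔ x ∈ affineSpan ℝ {z, w} := by
  simp only [mem_affineSpan_pair_iff_exists_lineMap_eq]
  refine exists_congr fun t => ?_
  rw [← param_lineMap, E.param_injective.eq_iff]

/-- In the coordinates that make `E` the unit circle, the ellipse `Ec` is `u ↦ c + α u + β ū`. -/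
theorem exists_param_eq_param (Ec : Ellipse) : ∃ c α β : ℂ, ‖α‖ ≠ ‖β‖ ∧
    ∀ u, E.param (c + α * u + β * conj u) = Ec.param u := by
  obtain ⟨e, he⟩ : ∃ e, e = conj E.dir * Ec.dir := ⟨_, rfl⟩
  obtain ⟨v, hv⟩ : ∃ v, v = conj E.dir * (Ec.center - E.center) := ⟨_, rfl⟩
  have ha : (E.a : ℂ) ≠ 0 := Complex.ofReal_ne_zero.2 E.a_pos.ne'
  have hb : (E.b : ℂ) ≠ 0 := Complex.ofReal_ne_zero.2 E.b_pos.ne'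
  have hd := E.conj_dir_mul_dir
  have hee : conj e * e = 1 := by
    rw [he]
    simp only [map_mul, Complex.conj_conj]
    linear_combination conj Ec.dir * Ec.dir * hd + Ec.conj_dir_mul_dir
  obtain ⟨m, hm⟩ : ∃ m, m = (E.a + E.b) / 2 := ⟨_, rfl⟩
  obtain ⟨n, hn⟩ : ∃ n, n = (E.a - E.b) / 2 := ⟨_, rfl⟩
  obtain ⟨m', hm'⟩ : ∃ m', m' = (Ec.a + Ec.b) / 2 := ⟨_, rfl⟩
  obtain ⟨n', hn'⟩ : ∃ n', n' = (Ec.a - Ec.b) / 2 := ⟨_, rfl⟩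
  have hab : (E.a * E.b : ℂ) = m ^ 2 - n ^ 2 := by rw [hm, hn]; push_cast; ring
  have hab0 : (m ^ 2 - n ^ 2 : ℂ) ≠ 0 := by rw [← hab]; exact mul_ne_zero ha hb
  refine ⟨(m * v - n * conj v) / (E.a * E.b),
    (m * e * m' - n * conj e * n') / (E.a * E.b),
    (m * e * n' - n * conj e * m') / (E.a * E.b), ?_, ?_⟩
  · intro h
    rw [norm_div, norm_div, div_left_inj' (norm_ne_zero_iff.2 (mul_ne_zero ha hb))] at h
    have h2 : ((‖m * e * m' - n * conj e * n'‖ : ℂ)) ^ 2 =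
      (‖m * e * n' - n * conj e * m'‖ : ℂ) ^ 2 := by rw [h]
    rw [← Complex.mul_conj', ← Complex.mul_conj'] at h2
    simp only [map_sub, map_mul, Complex.conj_ofReal, Complex.conj_conj] at h2
    have h3 : (E.a * E.b * (Ec.a * Ec.b) : ℂ) = 0 := by
      have : (Ec.a * Ec.b : ℂ) = m' ^ 2 - n' ^ 2 := by rw [hm', hn']; push_cast; ring
      rw [hab, this]
      linear_combination h2 - ((m ^ 2 - n ^ 2) * (m' ^ 2 - n' ^ 2) : ℂ) * hee
    have h4 : E.a * E.b * (Ec.a * Ec.b) = 0 := by exact_mod_cast h3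
    have := mul_pos (mul_pos E.a_pos E.b_pos) (mul_pos Ec.a_pos Ec.b_pos)
    linarith
  · intro u
    unfold param
    rw [← hm, ← hn, ← hm', ← hn', hab]
    simp only [map_add, map_sub, map_mul, map_div₀, map_pow, Complex.conj_ofReal,
      Complex.conj_conj]
    have hv' : E.dir * v = Ec.center - E.center := by
      rw [hv]; linear_combination (Ec.center - E.center) * hd
    have he' : E.dir * e = Ec.dir := by rw [he]; linear_combination Ec.dir * hd
    rw [← he']
    field_simp
    linear_combination (m ^ 2 - n ^ 2 : ℂ) * hv'

end Ellipse

theorem mem_affineSpan_pair_iff_of_norm_eq_one {x z w : ℂ} (hz : ‖z‖ = 1) (hw : ‖w‖ = 1)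
    (hne : z ≠ w) : x ∈ affineSpan ℝ {z, w} ↔ x + z * w * conj x = z + w := by
  have hz' := conj_mul_self_of_norm_eq_one hz
  have hw' := conj_mul_self_of_norm_eq_one hw
  rw [mem_affineSpan_pair_iff_exists_lineMap_eq]
  constructor
  · rintro ⟨t, rfl⟩
    simp only [AffineMap.lineMap_apply, vsub_eq_sub, vadd_eq_add, Complex.real_smul, map_add,
      map_mul, map_sub, Complex.conj_ofReal]
    linear_combination (t * z) * hw' + (1 - t) * w * hz'
  · intro h
    have h0 : w - z ≠ 0 := sub_ne_zero.2 hne.symm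
    have h1 : conj w - conj z ≠ 0 := by rw [← map_sub]; exact (map_ne_zero _).2 h0
    obtain ⟨t, ht⟩ := Complex.conj_eq_iff_real.1 (show conj ((x - z) / (w - z)) = _ by
      simp only [map_div₀, map_sub]
      rw [div_eq_div_iff h1 h0]
      have hx : conj x = conj w + conj z - x * conj z * conj w := by
        linear_combination conj z * conj w * h - (conj x * w * conj w - conj w) * hz'
          - (conj x - conj z) * hw'
      rw [hx]
      linear_combination (1 - x * conj z) * hw' + (x * conj w - 1) * hz')
    refine ⟨t, ?_⟩
    rw [AffineMap.lineMap_apply, vsub_eq_sub, vadd_eq_add, Complex.real_smul, ← ht]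
    field_simp
    ring

namespace Ellipse

theorem isTangent_affineSpan_iff {E Ec : Ellipse} {c α β z w : ℂ} (hαβ : ‖α‖ ≠ ‖β‖)
    (hEc : ∀ u, E.param (c + α * u + β * conj u) = Ec.param u) (hz : ‖z‖ = 1) (hw : ‖w‖ = 1)
    (hne : z ≠ w) :
    Ec.IsTangent (affineSpan ℝ {E.param z, E.param w}) ↔
    (z + w - c - conj c * (z * w)) ^ 2 =
      4 * ((α + conj β * (z * w)) * (β + conj α * (z * w))) := by
  rw [← existsUnique_mem_chord_iff hαβ hz hw, IsTangent,
    (Equiv.ofBijective _ ⟨Ec.param_injective, Ec.param_surjective⟩).symm.existsUnique_congr_left]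
  refine existsUnique_congr fun u => ?_
  change Ec.param u ∈ _ ∧ Ec.param u ∈ _ ↔ _
  rw [param_mem_curve_iff, ← hEc,
    param_mem_affineSpan_pair_iff, mem_affineSpan_pair_iff_of_norm_eq_one hz hw hne, and_comm]

end Ellipse

/-- The foci of an ellipse inside the unit circle lie inside the unit circle, because they lie on
the segment between its vertices. -/
theorem exists_foci_norm_lt_one {c α β : ℂ} (hαβ : ‖α‖ ≠ ‖β‖)
    (h : ∀ u : ℂ, ‖u‖ = 1 → ‖c + α * u + β * conj u‖ < 1) :
    ∃ f g : ℂ, f + g = 2 * c ∧ f * g = c ^ 2 - 4 * (α * β) ∧ ‖f‖ < 1 ∧ ‖g‖ < 1 := by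
  obtain ⟨e, he, u, hu, h1, h2⟩ : ∃ e : ℂ, e ^ 2 * (‖α‖ * ‖β‖ : ℝ) = α * β ∧ ∃ u : ℂ, ‖u‖ = 1 ∧
      α * u = ‖α‖ * e ∧ β * conj u = ‖β‖ * e := by
    have ha := Complex.norm_mul_exp_arg_mul_I α
    have hb := Complex.norm_mul_exp_arg_mul_I β
    set x := α.arg
    set y := β.arg
    have hc : conj (Complex.exp (((y - x) / 2 : ℝ) * Complex.I)) =
        Complex.exp (((x - y) / 2 : ℝ) * Complex.I) := by
      rw [← Complex.exp_conj, map_mul, Complex.conj_ofReal, Complex.conj_I]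
      congr 1; push_cast; ring
    refine ⟨Complex.exp (((x + y) / 2 : ℝ) * Complex.I), ?_,
      Complex.exp (((y - x) / 2 : ℝ) * Complex.I), Complex.norm_exp_ofReal_mul_I _, ?_, ?_⟩
    · have : Complex.exp (((x + y) / 2 : ℝ) * Complex.I) ^ 2 =
          Complex.exp (x * Complex.I) * Complex.exp (y * Complex.I) := by
        rw [← Complex.exp_nat_mul, ← Complex.exp_add]; congr 1; push_cast; ring
      rw [this, Complex.ofReal_mul]
      linear_combination Complex.exp (y * Complex.I) * ‖β‖ * ha + α * hb
    · nth_rewrite 1 [← ha]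
      rw [mul_assoc, ← Complex.exp_add]; congr 2; push_cast; ring
    · nth_rewrite 1 [← hb]
      rw [hc, mul_assoc, ← Complex.exp_add]; congr 2; push_cast; ring
  obtain ⟨M, hM⟩ : ∃ M, M = ‖α‖ + ‖β‖ := ⟨_, rfl⟩
  have hM0 : 0 < M := by
    rcases lt_or_gt_of_ne hαβ with h | h <;> linarith [norm_nonneg α, norm_nonneg β]
  have hp : ‖c + M * e‖ < 1 := by
    have := h u hu
    rwa [add_assoc, h1, h2, ← add_mul, ← Complex.ofReal_add, ← hM] at this
  have hm : ‖c - M * e‖ < 1 := by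
    have := h (-u) (by rwa [norm_neg])
    rwa [map_neg, mul_neg, mul_neg, add_assoc, h1, h2, ← neg_add, ← add_mul, ← Complex.ofReal_add,
      ← hM, ← sub_eq_add_neg] at this
  have key : ∀ t : ℝ, |t| ≤ M → ‖c + t * e‖ < 1 := by
    intro t ht
    obtain ⟨ht1, ht2⟩ := abs_le.1 ht
    have e1 : (M : ℂ) * (c + t * e) = (((M + t) / 2 : ℝ) : ℂ) * (c + M * e) +
        (((M - t) / 2 : ℝ) : ℂ) * (c - M * e) := by push_cast; ring
    have e2 := norm_add_le ((((M + t) / 2 : ℝ) : ℂ) * (c + M * e))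
      ((((M - t) / 2 : ℝ) : ℂ) * (c - M * e))
    rw [← e1, norm_mul, norm_mul, norm_mul, Complex.norm_of_nonneg hM0.le,
      Complex.norm_of_nonneg (by linarith), Complex.norm_of_nonneg (by linarith)] at e2
    by_contra hcon
    push Not at hcon
    have hs1 : (M + t) / 2 * ‖c + M * e‖ ≤ (M + t) / 2 * 1 :=
      mul_le_mul_of_nonneg_left hp.le (by linarith)
    have hs2 : (M - t) / 2 * ‖c - M * e‖ ≤ (M - t) / 2 * 1 :=
      mul_le_mul_of_nonneg_left hm.le (by linarith)
    rcases lt_or_ge 0 (M + t) with h0 | h0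
    · have : (M + t) / 2 * ‖c + M * e‖ < (M + t) / 2 * 1 := by gcongr
      nlinarith
    · have : (M - t) / 2 * ‖c - M * e‖ < (M - t) / 2 * 1 := by
        have : 0 < (M - t) / 2 := by linarith
        gcongr
      nlinarith
  obtain ⟨s, hs⟩ : ∃ s, s = Real.sqrt (‖α‖ * ‖β‖) := ⟨_, rfl⟩
  have hs0 : 0 ≤ s := hs ▸ Real.sqrt_nonneg _
  have hss : s ^ 2 = ‖α‖ * ‖β‖ := by rw [hs]; exact Real.sq_sqrt (by positivity)
  have hsM : 2 * s ≤ M := by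
    refine abs_le_of_sq_le_sq' ?_ hM0.le |>.2
    rw [hM]
    nlinarith [sq_nonneg (‖α‖ - ‖β‖)]
  refine ⟨c + (2 * s : ℝ) * e, c + (-(2 * s) : ℝ) * e, ?_, ?_, key _ ?_, key _ ?_⟩
  · push_cast; ring
  · rw [← he, ← hss]; push_cast; ring
  · rw [abs_of_nonneg (by linarith)]; exact hsM
  · rw [abs_neg, abs_of_nonneg (by linarith)]; exact hsM

/-! ### The circumcircles of the Poncelet triangles -/

namespace Ellipse

variable (E : Ellipse)

/-- The circumcenter of the triangle of `E` whose vertices are the images under `E.param` of the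
Blaschke triple of parameter `l`, when `‖l‖ = 1`; it is defined for all `l` by the same formula. -/
noncomputable def ponceletCircumcenter (f g l : ℂ) : ℂ :=
  E.center + E.dir * (((E.a ^ 2 - E.b ^ 2) / (4 * (E.a * E.b)) : ℝ) *
    (((E.a + E.b) / 2 : ℝ) * conj (f + g + l * conj (f * g) + conj l) -
      ((E.a - E.b) / 2 : ℝ) * (f + g + l * conj (f * g) + conj l)))

/-- The square of the circumradius of the triangle of `E` given by the Blaschke triple of
parameter `l`, when `‖l‖ = 1`; it is defined for all `l` by the same formula. -/
noncomputable def ponceletRadiusSq (f g l : ℂ) : ℝ :=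
  ‖E.ponceletCircumcenter f g l - E.center‖ ^ 2 + (E.a ^ 2 + E.b ^ 2) / 2 -
    (E.a ^ 2 - E.b ^ 2) / 2 * (f * g + conj l * (f + g)).re

theorem norm_param_sub_ponceletCircumcenter_sq (f g l : ℂ) {z : ℂ} (hz : ‖z‖ = 1) :
    ‖E.param z - E.ponceletCircumcenter f g l‖ ^ 2 =
      E.ponceletRadiusSq f g l + (E.a ^ 2 - E.b ^ 2) / 4 * circlePoly f g l z := by
  have hz' := conj_mul_self_of_norm_eq_one hz
  have ha : (E.a : ℂ) ≠ 0 := Complex.ofReal_ne_zero.2 E.a_pos.ne'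
  have hb : (E.b : ℂ) ≠ 0 := Complex.ofReal_ne_zero.2 E.b_pos.ne'
  obtain ⟨s, hs⟩ : ∃ s, s = f + g + l * conj (f * g) + conj l := ⟨_, rfl⟩
  obtain ⟨t, ht⟩ : ∃ t, t = f * g + conj l * (f + g) := ⟨_, rfl⟩
  obtain ⟨m, hm⟩ : ∃ m, m = (E.a + E.b) / 2 := ⟨_, rfl⟩
  obtain ⟨n, hn⟩ : ∃ n, n = (E.a - E.b) / 2 := ⟨_, rfl⟩
  obtain ⟨ξ, hξ⟩ : ∃ ξ : ℂ, ξ = ((E.a ^ 2 - E.b ^ 2) / (4 * (E.a * E.b)) : ℝ) *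
    (m * conj s - n * s) := ⟨_, rfl⟩
  have hmn : (E.a ^ 2 - E.b ^ 2) / 4 = m * n := by rw [hm, hn]; ring
  have hmn2 : (E.a ^ 2 - E.b ^ 2) / 2 = 2 * m * n := by rw [hm, hn]; ring
  have hmm : (E.a ^ 2 + E.b ^ 2) / 2 = m ^ 2 + n ^ 2 := by rw [hm, hn]; ring
  have hξs : m * conj ξ + n * ξ = m * n * s := by
    rw [hξ, hm, hn]
    simp only [map_sub, map_mul, Complex.conj_ofReal, Complex.conj_conj]
    push_cast
    field_simp
    ring
  have hξs' : m * ξ + n * conj ξ = m * n * conj s := by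
    have := congrArg conj hξs
    simpa only [map_add, map_mul, Complex.conj_ofReal, Complex.conj_conj] using this
  have hX : E.ponceletCircumcenter f g l = E.center + E.dir * ξ := by
    rw [hξ, hm, hn, hs]; rfl
  have h1 : ‖E.param z - E.ponceletCircumcenter f g l‖ = ‖m * z + n * conj z - ξ‖ := by
    rw [hX, param, ← hm, ← hn, add_sub_add_left_eq_sub, ← mul_sub, norm_mul, E.norm_dir, one_mul]
  rw [ponceletRadiusSq, h1, hX, add_sub_cancel_left, norm_mul, E.norm_dir, one_mul, hmn, hmn2, hmm,
    circlePoly, ← hs, ← ht]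
  apply Complex.ofReal_injective
  push_cast
  rw [← Complex.mul_conj', ← Complex.mul_conj', Complex.re_eq_add_conj, Complex.re_eq_add_conj]
  simp only [map_add, map_sub, map_mul, map_pow, Complex.conj_ofReal, Complex.conj_conj]
  linear_combination -z * hξs - conj z * hξs' + (m ^ 2 + n ^ 2 : ℂ) * hz'

theorem norm_param_sub_ponceletCircumcenter_sq_of_isBlaschkeTriple {f g l z₁ z₂ z₃ : ℂ}
    (h : IsBlaschkeTriple f g l z₁ z₂ z₃) (hl : ‖l‖ = 1) (hz : ‖z₁‖ = 1) :
    ‖E.param z₁ - E.ponceletCircumcenter f g l‖ ^ 2 = E.ponceletRadiusSq f g l := by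
  rw [E.norm_param_sub_ponceletCircumcenter_sq f g l hz, h.circlePoly_eq_zero hl hz, mul_zero,
    add_zero]

/-- The weighted mean over a Blaschke triple of the squared distance to the center is the squared
radius, so the latter is positive even for parameters off the unit circle. -/
theorem ponceletRadiusSq_pos {f g : ℂ} (hf : ‖f‖ < 1) (hg : ‖g‖ < 1) (k : ℂ) :
    0 < E.ponceletRadiusSq f g k := by
  obtain ⟨z₁, z₂, z₃, h⟩ := exists_isBlaschkeTriple f g 1
  have hl : ‖(1 : ℂ)‖ = 1 := norm_one
  have n1 := h.norm_eq_one hf hg hl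
  have n2 := h.rotate.norm_eq_one hf hg hl
  have n3 := h.rotate.rotate.norm_eq_one hf hg hl
  have w1 := clarkWeight_pos hf hg n1
  have w2 := clarkWeight_pos hf hg n2
  have w3 := clarkWeight_pos hf hg n3
  have e1 := E.norm_param_sub_ponceletCircumcenter_sq f g k n1
  have e2 := E.norm_param_sub_ponceletCircumcenter_sq f g k n2
  have e3 := E.norm_param_sub_ponceletCircumcenter_sq f g k n3
  have hsum := h.sum_clarkWeight_mul_circlePoly hf hg hl k
  set X := E.ponceletCircumcenter f g k
  set R := E.ponceletRadiusSq f g k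
  have key : clarkWeight f g z₁ * ‖E.param z₁ - X‖ ^ 2 + clarkWeight f g z₂ * ‖E.param z₂ - X‖ ^ 2 +
      clarkWeight f g z₃ * ‖E.param z₃ - X‖ ^ 2 =
      (clarkWeight f g z₁ + clarkWeight f g z₂ + clarkWeight f g z₃) * R := by
    rw [e1, e2, e3]
    linear_combination (E.a ^ 2 - E.b ^ 2) / 4 * hsum
  by_contra hR
  have hR' : (clarkWeight f g z₁ + clarkWeight f g z₂ + clarkWeight f g z₃) * R ≤ 0 :=
    mul_nonpos_of_nonneg_of_nonpos (by positivity) (not_lt.1 hR)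
  have p1 : 0 ≤ clarkWeight f g z₁ * ‖E.param z₁ - X‖ ^ 2 := by positivity
  have p2 : 0 ≤ clarkWeight f g z₂ * ‖E.param z₂ - X‖ ^ 2 := by positivity
  have p3 : 0 ≤ clarkWeight f g z₃ * ‖E.param z₃ - X‖ ^ 2 := by positivity
  have q1 : clarkWeight f g z₁ * ‖E.param z₁ - X‖ ^ 2 = 0 := by linarith
  have q2 : clarkWeight f g z₂ * ‖E.param z₂ - X‖ ^ 2 = 0 := by linarith
  have r1 : E.param z₁ = X := by simpa [w1.ne', sub_eq_zero] using q1
  have r2 : E.param z₂ = X := by simpa [w2.ne', sub_eq_zero] using q2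
  exact h.ne hf hg hl (E.param_injective (r1.trans r2.symm))

/-- The locus of the circumcenter is the image of the circle of parameters `l` under a real affine
map, which is bijective because `E` is not a circle. -/
theorem exists_ponceletCircumcenter_eq (hE : E.a ≠ E.b) {f g : ℂ} (hf : ‖f‖ < 1) (hg : ‖g‖ < 1) :
    ∃ x₀ x₁ x₂ : ℂ, (∀ l, E.ponceletCircumcenter f g l = x₀ + l * x₁ + conj l * x₂) ∧
      ∀ l, l * x₁ + conj l * x₂ = 0 → l = 0 := by
  have ha := E.a_pos
  have hb := E.b_pos
  obtain ⟨m, hm⟩ : ∃ m, m = (E.a + E.b) / 2 := ⟨_, rfl⟩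
  obtain ⟨n, hn⟩ : ∃ n, n = (E.a - E.b) / 2 := ⟨_, rfl⟩
  obtain ⟨K, hK⟩ : ∃ K, K = (E.a ^ 2 - E.b ^ 2) / (4 * (E.a * E.b)) := ⟨_, rfl⟩
  have hK0 : K ≠ 0 := by
    rw [hK]
    refine div_ne_zero ?_ (by positivity)
    have : E.a ^ 2 - E.b ^ 2 = (E.a - E.b) * (E.a + E.b) := by ring
    rw [this]
    exact mul_ne_zero (sub_ne_zero.2 hE) (by positivity)
  refine ⟨E.center + E.dir * (K * (m * conj (f + g) - n * (f + g))),
    E.dir * (K * (m - n * conj (f * g))), E.dir * (K * (m * (f * g) - n)), ?_, ?_⟩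
  · intro l
    rw [ponceletCircumcenter, ← hm, ← hn, ← hK]
    simp only [map_add, map_mul, Complex.conj_conj]
    ring
  · intro l h
    have h1 : E.dir * K * (m * conj (l * conj (f * g) + conj l) -
        n * (l * conj (f * g) + conj l)) = 0 := by
      rw [← h]
      simp only [map_add, map_mul, Complex.conj_conj]
      ring
    have h2 := (mul_eq_zero.1 h1).resolve_left
      (mul_ne_zero E.dir_ne_zero (Complex.ofReal_ne_zero.2 hK0))
    have h3 := congrArg norm (sub_eq_zero.1 h2)
    rw [norm_mul, norm_mul, RCLike.norm_conj, Complex.norm_real, Complex.norm_real] at h3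
    have hmn : ‖n‖ < ‖m‖ := by
      rw [Real.norm_eq_abs, Real.norm_eq_abs, hm, hn,
        abs_of_pos (by positivity : 0 < (E.a + E.b) / 2),
        abs_lt]
      constructor <;> linarith
    have h4 : ‖l * conj (f * g) + conj l‖ = 0 := by
      by_contra h0
      have := mul_right_cancel₀ h0 h3
      linarith
    have h5 := congrArg norm (eq_neg_of_add_eq_zero_left (norm_eq_zero.1 h4))
    rw [norm_neg, norm_mul, RCLike.norm_conj, RCLike.norm_conj, norm_mul] at h5
    have h6 : ‖f‖ * ‖g‖ < 1 := by
      nlinarith [norm_nonneg f, norm_nonneg g]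
    by_contra hl
    have := norm_pos_iff.2 hl
    nlinarith

/-- The power of a point with respect to the circumcircle is a real affine function of `l`. -/
theorem exists_power_eq {f g O x₀ x₁ x₂ : ℂ}
    (hx : ∀ l, E.ponceletCircumcenter f g l = x₀ + l * x₁ + conj l * x₂) :
    ∃ (w₀ : ℝ) (w₁ : ℂ), ∀ l, ‖O - E.ponceletCircumcenter f g l‖ ^ 2 - E.ponceletRadiusSq f g l =
      w₀ + (w₁ * l).re := by
  obtain ⟨c, hc⟩ : ∃ c, c = E.center := ⟨_, rfl⟩
  obtain ⟨k, hk⟩ : ∃ k, k = (E.a ^ 2 - E.b ^ 2) / 2 := ⟨_, rfl⟩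
  refine ⟨‖O‖ ^ 2 - ‖c‖ ^ 2 - (E.a ^ 2 + E.b ^ 2) / 2 + k * (f * g).re -
      2 * (conj (O - c) * x₀).re,
    k * conj (f + g) - 2 * (conj (O - c) * x₁ + (O - c) * conj x₂), fun l => ?_⟩
  rw [ponceletRadiusSq, hx, ← hc, ← hk]
  simp only [← Complex.normSq_eq_norm_sq, Complex.normSq_apply, Complex.sub_re, Complex.sub_im,
    Complex.add_re, Complex.add_im, Complex.mul_re, Complex.mul_im, Complex.conj_re,
    Complex.conj_im, Complex.ofReal_re, Complex.ofReal_im, Complex.re_ofNat, Complex.im_ofNat]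
  ring

end Ellipse

/-! ### Inversion of a triangle inscribed in a circle -/

theorem inversion_eq_add_div (O : ℂ) (r : ℝ) (P : ℂ) :
    EuclideanGeometry.inversion O r P = O + ((r ^ 2 / ‖P - O‖ ^ 2 : ℝ) : ℂ) * (P - O) := by
  rw [EuclideanGeometry.inversion, vsub_eq_sub, vadd_eq_add, dist_eq_norm, div_pow,
    Complex.real_smul, add_comm]

/-- The image of a circle under inversion is the circle obtained from it by the homothety of
ratio `r² / power` about the center of inversion. -/
theorem norm_inversion_sub_sq {O X P : ℂ} {r R : ℝ} (hP : ‖P - X‖ ^ 2 = R) (hPO : P ≠ O)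
    (hpow : ‖O - X‖ ^ 2 - R ≠ 0) :
    ‖EuclideanGeometry.inversion O r P -
        (O + (r ^ 2 * (X - O)) / ((‖O - X‖ ^ 2 - R : ℝ) : ℂ))‖ ^ 2 =
      r ^ 4 * R / (‖O - X‖ ^ 2 - R) ^ 2 := by
  obtain ⟨W, hW⟩ : ∃ W, W = ‖O - X‖ ^ 2 - R := ⟨_, rfl⟩
  obtain ⟨N, hN⟩ : ∃ N, N = ‖P - O‖ ^ 2 := ⟨_, rfl⟩
  have hN0 : N ≠ 0 := by rw [hN]; exact pow_ne_zero _ (norm_ne_zero_iff.2 (sub_ne_zero.2 hPO))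
  rw [← hW] at hpow ⊢
  rw [inversion_eq_add_div, ← hN]
  have e : O + ((r ^ 2 / N : ℝ) : ℂ) * (P - O) - (O + r ^ 2 * (X - O) / (W : ℂ)) =
      ((r ^ 2 / (N * W) : ℝ) : ℂ) * (W * (P - O) - N * (X - O)) := by
    have := Complex.ofReal_ne_zero.2 hN0
    have := Complex.ofReal_ne_zero.2 hpow
    push_cast
    field_simp
    ring
  have e2 : ‖(W * (P - O) - N * (X - O) : ℂ)‖ ^ 2 = N ^ 2 * R := by
    rw [← Complex.normSq_eq_norm_sq, Complex.normSq_apply] at hP hN hW ⊢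
    simp only [Complex.sub_re, Complex.sub_im, Complex.mul_re, Complex.mul_im, Complex.ofReal_re,
      Complex.ofReal_im] at hP hN hW ⊢
    linear_combination W * N * hP - (W ^ 2 - W * N) * hN - (N ^ 2 - W * N) * hW
  rw [e, norm_mul, mul_pow, e2, Complex.norm_real, Real.norm_eq_abs, sq_abs]
  field_simp

theorem inversion_mem_line {O X P : ℂ} {r R : ℝ} (hP : ‖P - X‖ ^ 2 = R) (hPO : P ≠ O)
    (hpow : ‖O - X‖ ^ 2 - R = 0) :
    2 * (conj (X - O) * (EuclideanGeometry.inversion O r P - O)).re = r ^ 2 := by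
  have hN0 : ‖P - O‖ ^ 2 ≠ 0 := pow_ne_zero _ (norm_ne_zero_iff.2 (sub_ne_zero.2 hPO))
  have h : 2 * (conj (X - O) * (P - O)).re = ‖P - O‖ ^ 2 := by
    rw [← hP, ← Complex.normSq_eq_norm_sq, ← Complex.normSq_eq_norm_sq, Complex.normSq_apply,
      Complex.normSq_apply] at hpow
    rw [← Complex.normSq_eq_norm_sq, Complex.normSq_apply]
    simp only [Complex.sub_re, Complex.sub_im, Complex.mul_re, Complex.conj_re, Complex.conj_im]
      at hpow ⊢
    linear_combination hpow
  rw [inversion_eq_add_div, add_sub_cancel_left, mul_left_comm, Complex.re_ofReal_mul,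
    mul_left_comm, h, div_mul_cancel₀ _ hN0]

theorem affineSpan_range_points_eq_top (T : Affine.Triangle ℝ ℂ) :
    affineSpan ℝ (Set.range T.points) = ⊤ := by
  rw [T.independent.affineSpan_eq_top_iff_card_eq_finrank_add_one, Complex.finrank_real_complex]
  rfl

theorem IsInversiveTriangle.circumcenter_eq {O X : ℂ} {r R : ℝ} (hr : 0 < r)
    {T T' : Affine.Triangle ℝ ℂ} (h : IsInversiveTriangle O r T T')
    (hT : ∀ i, ‖T.points i - X‖ ^ 2 = R) :
    ‖O - X‖ ^ 2 - R ≠ 0 ∧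
      T'.circumcenter = O + (r ^ 2 * (X - O)) / ((‖O - X‖ ^ 2 - R : ℝ) : ℂ) := by
  have hpow : ‖O - X‖ ^ 2 - R ≠ 0 := by
    intro hpow
    -- The inverses of the vertices would lie on a line that misses `O`.
    have hO : O ∈ affineSpan ℝ (Set.range T'.points) := by
      rw [affineSpan_range_points_eq_top]; trivial
    have : 2 * (conj (X - O) * (O - O)).re = r ^ 2 := by
      refine affineSpan_induction (p := fun x => 2 * (conj (X - O) * (x - O)).re = r ^ 2) hO ?_ ?_
      · rintro _ ⟨i, rfl⟩
        rw [(h i).2]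
        exact inversion_mem_line (hT i) (h i).1 hpow
      · intro c u v w hu hv hw
        have e : conj (X - O) * ((c • (u -ᵥ v) +ᵥ w) - O) = c * (conj (X - O) * (u - O)) -
            c * (conj (X - O) * (v - O)) + conj (X - O) * (w - O) := by
          rw [vsub_eq_sub, vadd_eq_add, Complex.real_smul]; ring
        rw [e, Complex.add_re, Complex.sub_re, Complex.re_ofReal_mul, Complex.re_ofReal_mul]
        linear_combination c * hu - c * hv + hw
    rw [sub_self, mul_zero, Complex.zero_re, mul_zero] at this
    exact (pow_pos hr 2).ne this
  refine ⟨hpow, ?_⟩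
  symm
  apply Affine.Simplex.eq_circumcenter_of_dist_eq
    (r := Real.sqrt (r ^ 4 * R / (‖O - X‖ ^ 2 - R) ^ 2))
  · intro i
    rw [(h i).2, dist_eq_norm, ← norm_inversion_sub_sq (hT i) (h i).1 hpow,
      Real.sqrt_sq (norm_nonneg _)]
  · rw [affineSpan_range_points_eq_top]; trivial

/-- Three distinct points at the same distance from `X` form a triangle. -/
theorem exists_triangle_of_norm_sub_sq_eq {p : Fin 3 → ℂ} (hp : Function.Injective p) {X : ℂ}
    {R : ℝ} (h : ∀ i, ‖p i - X‖ ^ 2 = R) : ∃ T : Affine.Triangle ℝ ℂ, T.points = p := by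
  have hc : EuclideanGeometry.Cospherical (Set.range p) := by
    refine ⟨X, Real.sqrt R, ?_⟩
    rintro _ ⟨i, rfl⟩
    rw [dist_eq_norm, ← h i, Real.sqrt_sq (norm_nonneg _)]
  exact ⟨⟨p, hc.affineIndependent subset_rfl hp⟩, rfl⟩

theorem exists_isInversiveTriangle {O X : ℂ} {r R : ℝ} (hr : 0 < r) {T : Affine.Triangle ℝ ℂ}
    (hT : ∀ i, ‖T.points i - X‖ ^ 2 = R) (hpow : ‖O - X‖ ^ 2 - R ≠ 0) :
    ∃ T', IsInversiveTriangle O r T T' := by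
  have hO : ∀ i, T.points i ≠ O := by
    intro i hi
    apply hpow
    rw [← hi, hT i, sub_self]
  obtain ⟨T', hT'⟩ := exists_triangle_of_norm_sub_sq_eq
    ((EuclideanGeometry.inversion_injective O hr.ne').comp T.independent.injective)
    (fun i => norm_inversion_sub_sq (r := r) (hT i) (hO i) hpow)
  exact ⟨T', fun i => ⟨hO i, congrFun hT' i⟩⟩

/-! ### The Poncelet family -/

theorem IsPonceletTriangle.exists_isBlaschkeTriple {E Ec : Ellipse} {c α β f g : ℂ}
    (hαβ : ‖α‖ ≠ ‖β‖) (hEc : ∀ u, E.param (c + α * u + β * conj u) = Ec.param u)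
    (hfg : f + g = 2 * c) (hfg' : f * g = c ^ 2 - 4 * (α * β))
    {T : Affine.Triangle ℝ ℂ} (hT : IsPonceletTriangle E Ec T) :
    (∃ l z₁ z₂ z₃ : ℂ, ‖l‖ = 1 ∧ IsBlaschkeTriple f g l z₁ z₂ z₃ ∧
      ‖z₁‖ = 1 ∧ ‖z₂‖ = 1 ∧ ‖z₃‖ = 1 ∧ T.points = ![E.param z₁, E.param z₂, E.param z₃]) ∧
      1 + f * g * conj (f * g) =
        2 * (c * conj c) + 4 * (α * conj α) + 4 * (β * conj β) := by
  obtain ⟨hc, ht⟩ := hT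
  choose z hz hzT using fun i => E.exists_param_eq_of_mem_curve (hc i)
  have hne : ∀ i j, i ≠ j → z i ≠ z j := by
    intro i j hij h
    apply hij
    apply T.independent.injective
    rw [← hzT, ← hzT, h]
  have ht' := fun i j (hij : i ≠ j) => (Ellipse.isTangent_affineSpan_iff hαβ hEc (hz i) (hz j)
    (hne i j hij)).1 (by rw [hzT, hzT]; exact ht i j hij)
  have hz0 : ∀ i, z i ≠ 0 := fun i h => by have := hz i; rw [h] at this; simp at this
  obtain ⟨h1, h2⟩ := isBlaschkeTriple_of_tangent hfg hfg' (hz0 0) (hz0 1)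
    (hne 0 1 (by decide)) (hne 1 2 (by decide)) (hne 2 0 (by decide))
    (ht' 0 1 (by decide)) (ht' 1 2 (by decide)) (ht' 2 0 (by decide))
  refine ⟨⟨_, z 0, z 1, z 2, ?_, h1, hz 0, hz 1, hz 2, ?_⟩, h2⟩
  · simp [hz]
  · ext i
    fin_cases i <;> simp [hzT]

/-- Poncelet's closure theorem for triangles: once the ellipses satisfy the closure condition, each
parameter `l` on the unit circle gives a triangle of the family. -/
theorem exists_isPonceletTriangle {E Ec : Ellipse} {c α β f g l : ℂ}
    (hαβ : ‖α‖ ≠ ‖β‖) (hEc : ∀ u, E.param (c + α * u + β * conj u) = Ec.param u)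
    (hfg : f + g = 2 * c) (hfg' : f * g = c ^ 2 - 4 * (α * β)) (hf : ‖f‖ < 1) (hg : ‖g‖ < 1)
    (hclosure : 1 + f * g * conj (f * g) =
        2 * (c * conj c) + 4 * (α * conj α) + 4 * (β * conj β)) (hl : ‖l‖ = 1) :
    ∃ T : Affine.Triangle ℝ ℂ, IsPonceletTriangle E Ec T ∧
      ∀ i, ‖T.points i - E.ponceletCircumcenter f g l‖ ^ 2 = E.ponceletRadiusSq f g l := by
  obtain ⟨z₁, z₂, z₃, h⟩ := _root_.exists_isBlaschkeTriple f g l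
  have h' := h.rotate
  have h'' := h'.rotate
  have n1 := h.norm_eq_one hf hg hl
  have n2 := h'.norm_eq_one hf hg hl
  have n3 := h''.norm_eq_one hf hg hl
  have d12 := h.ne hf hg hl
  have d23 := h'.ne hf hg hl
  have d31 := h''.ne hf hg hl
  have t12 := (Ellipse.isTangent_affineSpan_iff hαβ hEc n1 n2 d12).2
    (h.tangent hfg hfg' d12 hclosure)
  have t23 := (Ellipse.isTangent_affineSpan_iff hαβ hEc n2 n3 d23).2
    (h'.tangent hfg hfg' d23 hclosure)
  have t31 := (Ellipse.isTangent_affineSpan_iff hαβ hEc n3 n1 d31).2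
    (h''.tangent hfg hfg' d31 hclosure)
  have c1 := E.norm_param_sub_ponceletCircumcenter_sq_of_isBlaschkeTriple h hl n1
  have c2 := E.norm_param_sub_ponceletCircumcenter_sq_of_isBlaschkeTriple h' hl n2
  have c3 := E.norm_param_sub_ponceletCircumcenter_sq_of_isBlaschkeTriple h'' hl n3
  have hcirc : ∀ i, ‖(![E.param z₁, E.param z₂, E.param z₃] : Fin 3 → ℂ) i -
      E.ponceletCircumcenter f g l‖ ^ 2 = E.ponceletRadiusSq f g l := by
    intro i
    fin_cases i
    exacts [c1, c2, c3]
  obtain ⟨T, hT⟩ := exists_triangle_of_norm_sub_sq_eq (by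
    have i12 := E.param_injective.ne d12
    have i23 := E.param_injective.ne d23
    have i31 := E.param_injective.ne d31
    intro i j hij
    fin_cases i <;> fin_cases j
    exacts [rfl, absurd hij i12, absurd hij.symm i31, absurd hij.symm i12, rfl, absurd hij i23,
      absurd hij i31, absurd hij.symm i23, rfl]) hcirc
  refine ⟨T, ⟨?_, ?_⟩, by rwa [hT]⟩
  · intro i
    rw [hT]
    fin_cases i
    exacts [(E.param_mem_curve_iff _).2 n1, (E.param_mem_curve_iff _).2 n2,
      (E.param_mem_curve_iff _).2 n3]
  · intro i j hij
    rw [hT]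
    have t21 := t12
    have t32 := t23
    have t13 := t31
    rw [Set.pair_comm] at t21 t32 t13
    fin_cases i <;> fin_cases j
    exacts [absurd rfl hij, t12, t13, t21, absurd rfl hij, t23, t31, t32, absurd rfl hij]

/-! ### The locus of the inversive circumcenter -/

theorem mainTheorem1 (E Ec : Ellipse)
    (hnoncirc : E.a ≠ E.b)
    (hnested : Ec.curve ⊆ E.inside)
    (hponcelet : ∃ T : Affine.Triangle ℝ ℂ, IsPonceletTriangle E Ec T)
    (O : ℂ) (r : ℝ) (hr : 0 < r) :
    IsNondegenerateConic (inversiveCircumcenterLocus E Ec O r) := by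
  obtain ⟨c, α, β, hαβ, hEc⟩ := E.exists_param_eq_param Ec
  obtain ⟨f, g, hfg, hfg', hf, hg⟩ := exists_foci_norm_lt_one (c := c) hαβ (by
    intro u hu
    rw [← E.param_mem_inside_iff, hEc]
    exact hnested ((Ec.param_mem_curve_iff u).2 hu))
  obtain ⟨T₀, hT₀⟩ := hponcelet
  have hclosure := (hT₀.exists_isBlaschkeTriple hαβ hEc hfg hfg').2
  obtain ⟨x₀, x₁, x₂, hX, hX0⟩ := E.exists_ponceletCircumcenter_eq hnoncirc hf hg
  obtain ⟨w₀, w₁, hW⟩ := E.exists_power_eq (O := O) hX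
  have hr0 : (r ^ 2 : ℂ) ≠ 0 := pow_ne_zero 2 (Complex.ofReal_ne_zero.2 hr.ne')
  have hY : ∀ l, r ^ 2 * (x₀ - O) + l * (r ^ 2 * x₁) + conj l * (r ^ 2 * x₂) =
      r ^ 2 * (E.ponceletCircumcenter f g l - O) := by
    intro l; rw [hX]; ring
  have hconic := isNondegenerateConic_of_unitCircle O (r ^ 2 * (x₀ - O)) (r ^ 2 * x₁) (r ^ 2 * x₂)
    w₁ w₀ (by
      intro l hl
      apply hX0
      apply mul_left_cancel₀ hr0
      linear_combination hl) (by
      intro l hl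
      rw [hY, mul_eq_zero, sub_eq_zero] at hl
      rw [← hW, hl.resolve_left hr0, sub_self, norm_zero]
      have := E.ponceletRadiusSq_pos hf hg l
      intro h0
      linarith)
  convert hconic using 1
  ext X
  simp only [hY, ← hW, inversiveCircumcenterLocus, Set.mem_ofPred_eq]
  constructor
  · rintro ⟨T, T', hT, hT', rfl⟩
    obtain ⟨⟨l, z₁, z₂, z₃, hl, h, n1, n2, n3, hpts⟩, -⟩ :=
      hT.exists_isBlaschkeTriple hαβ hEc hfg hfg'
    refine ⟨l, hl, hT'.circumcenter_eq hr fun i => ?_⟩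
    rw [hpts]
    fin_cases i
    exacts [E.norm_param_sub_ponceletCircumcenter_sq_of_isBlaschkeTriple h hl n1,
      E.norm_param_sub_ponceletCircumcenter_sq_of_isBlaschkeTriple h.rotate hl n2,
      E.norm_param_sub_ponceletCircumcenter_sq_of_isBlaschkeTriple h.rotate.rotate hl n3]
  · rintro ⟨l, hl, hpow, rfl⟩
    obtain ⟨T, hT, hcirc⟩ := exists_isPonceletTriangle hαβ hEc hfg hfg' hf hg hclosure hl
    obtain ⟨T', hT'⟩ := exists_isInversiveTriangle hr hcirc hpow
    exact ⟨T, T', hT, hT', (hT'.circumcenter_eq hr hcirc).2.symm⟩
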